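/- Let $S$ be a semigroup with zero $0$ (we write $0$ also for $\{0\}$). A right ideal is a non-empty subset $I\subseteq S$ with $IS\subseteq I$, dually for left ideals; $S$ is right noetherian if every ascending chain of right ideals of $S$ terminates. A right (left) ideal $I\neq 0$ is $0$-minimal if the only right (left) ideals of $S$ contained in $I$ are $0$ and $I$; it is null if $I^2=0$ and globally idempotent if $I^2=I$. Let $\Sigma^l$ (resp. $\Sigma^r$) be the union of $0$ and all $0$-minimal left (resp. right) ideals of $S$, and let $A^l$ (resp. $B^l$) be the union of $0$ and all null (resp. globally idempotent) $0$-minimal left ideals of $S$. The set $\Sigma^r$ is a two-sided ideal, and $S/\Sigma^r$ denotes the Rees quotient. Elements $a,b$ of a semigroup $T$ lie in the same $\mathcal R$-class if $aT^1=bT^1$. A semigroup $T$ with zero is null if $T^2=0$; it is completely $0$-simple if $T^2\neq 0$, its only two-sided ideals are $0$ and $T$, and it has both a $0$-minimal right ideal and a $0$-minimal left ideal. A semigroup with zero is the $0$-direct union of subsemigroups $T_i$ $(i\in I)$ if it is the union of the $T_i$, and $T_i\cap T_j=0$ and $T_iT_j=0$ for all $i\neq j$. Suppose that $S=\Sigma^l$.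 Then the following are equivalent: (1) $S$ is right noetherian; (2) $A^l$ is finite, and $B^l$ is either $0$ or the $0$-direct union of finitely many completely $0$-simple semigroups that each have finitely many $\mathcal R$-classes; (3) $\Sigma^r$ is either a finite null semigroup or the $0$-direct union of a finite null semigroup and finitely many completely $0$-simple semigroups that each have finitely many $\mathcal R$-classes, and either $\Sigma^r=S$ or $S/\Sigma^r$ is the $0$-direct union of finitely many completely $0$-simple semigroups that each have finitely many $\mathcal R$-classes; (4) $S$ has finitely many $\mathcal R$-classes. -/

import Mathlib

open scoped Pointwise

namespace SocleSemigroup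

section Ideals

variable {S : Type*} [Semigroup S]

/-- A right ideal: a non-empty subset `I` with `I S ⊆ I`. -/
def IsRightIdeal (I : Set S) : Prop :=
  I.Nonempty ∧ ∀ a ∈ I, ∀ s : S, a * s ∈ I

/-- A left ideal: a non-empty subset `I` with `S I ⊆ I`. -/
def IsLeftIdeal (I : Set S) : Prop :=
  I.Nonempty ∧ ∀ a ∈ I, ∀ s : S, s * a ∈ I

/-- A two-sided ideal. -/
def IsIdeal (I : Set S) : Prop :=
  IsRightIdeal I ∧ IsLeftIdeal I

/-- The principal right ideal `a S¹ = {a} ∪ a S`. -/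
def principalRightIdeal (a : S) : Set S :=
  {x | x = a ∨ ∃ s : S, x = a * s}

end Ideals

/-- Every ascending chain of right ideals eventually terminates. -/
def IsRightNoetherian (S : Type*) [Semigroup S] : Prop :=
  ∀ I : ℕ → Set S, (∀ n, IsRightIdeal (I n)) → Monotone I → ∃ n, ∀ m, n ≤ m → I m = I n

/-- Green's relation `R`: `a R b` iff `a S¹ = b S¹`. -/
def greenR (S : Type*) [Semigroup S] : Setoid S where
  r a b := principalRightIdeal a = principalRightIdeal b
  iseqv := ⟨fun _ => rfl, fun h => h.symm, fun h k => h.trans k⟩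

/-- There are only finitely many classes of Green's relation `R`. -/
def HasFinitelyManyRClasses (S : Type*) [Semigroup S] : Prop :=
  Finite (Quotient (greenR S))

section WithZeroElement

variable {S : Type*} [SemigroupWithZero S]

/-- A 0-minimal right ideal. -/
def IsZeroMinimalRightIdeal (R : Set S) : Prop :=
  IsRightIdeal R ∧ R ≠ {0} ∧ ∀ J : Set S, IsRightIdeal J → J ⊆ R → J = {0} ∨ J = R

/-- A 0-minimal left ideal. -/
def IsZeroMinimalLeftIdeal (L : Set S) : Prop :=
  IsLeftIdeal L ∧ L ≠ {0} ∧ ∀ J : Set S, IsLeftIdeal J → J ⊆ L → J = {0} ∨ J = L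

/-- A subset is null if `X X = 0`. -/
def IsNull (X : Set S) : Prop := X * X = {0}

/-- A subset is globally idempotent if `X X = X`. -/
def IsGloballyIdempotent (X : Set S) : Prop := X * X = X

end WithZeroElement

section Socles

variable (S : Type*) [SemigroupWithZero S]

/-- `Σʳ`: the union of `0` and all 0-minimal right ideals. -/
def rightSocle : Set S :=
  {0} ∪ ⋃₀ {R | IsZeroMinimalRightIdeal R}

/-- `Σˡ`: the union of `0` and all 0-minimal left ideals. -/
def leftSocle : Set S :=
  {0} ∪ ⋃₀ {L | IsZeroMinimalLeftIdeal L}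

/-- `Aˡ`: the union of `0` and all null 0-minimal left ideals. -/
def leftNullPart : Set S :=
  {0} ∪ ⋃₀ {L | IsZeroMinimalLeftIdeal L ∧ IsNull L}

/-- `Bˡ`: the union of `0` and all globally idempotent 0-minimal left ideals. -/
def leftIdempotentPart : Set S :=
  {0} ∪ ⋃₀ {L | IsZeroMinimalLeftIdeal L ∧ IsGloballyIdempotent L}

/-- `S² ≠ 0`, and `0` is the only proper two-sided ideal of `S`. -/
def IsZeroSimple : Prop :=
  (∃ a b : S, a * b ≠ 0) ∧ ∀ I : Set S, IsIdeal I → I = {0} ∨ I = Set.univ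

/-- A 0-simple semigroup possessing both 0-minimal right ideals and 0-minimal left ideals. -/
def IsCompletelyZeroSimple : Prop :=
  IsZeroSimple S ∧ (∃ R : Set S, IsZeroMinimalRightIdeal R) ∧
    ∃ L : Set S, IsZeroMinimalLeftIdeal L

/-- A subsemigroup of `S` containing the zero of `S`. -/
structure ZeroSubsemigroup extends Subsemigroup S where
  zero_mem' : (0 : S) ∈ carrier

end Socles

namespace ZeroSubsemigroup

variable {S : Type*} [SemigroupWithZero S]

/-- The elements of a subsemigroup with zero, as a type. -/
abbrev Elem (B : ZeroSubsemigroup S) : Type _ := B.toSubsemigroup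

instance (B : ZeroSubsemigroup S) : SemigroupWithZero B.Elem where
  mul_assoc := mul_assoc
  zero := ⟨0, B.zero_mem'⟩
  zero_mul a := Subtype.ext (zero_mul (a : S))
  mul_zero a := Subtype.ext (mul_zero (a : S))

end ZeroSubsemigroup

section ZeroDirect

variable {S : Type*} [SemigroupWithZero S]

/-- The subset `X` of `S` is the 0-direct union of the subsemigroups `B i`: it is their union,
and `B i ∩ B j = 0` and `B i B j = 0` for `i ≠ j`. -/
def IsZeroDirectUnion {ι : Type*} (X : Set S) (B : ι → ZeroSubsemigroup S) : Prop :=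
  X = ⋃ i, (B i).carrier ∧
    (∀ i j, i ≠ j → (B i).carrier ∩ (B j).carrier = {0}) ∧
    (∀ i j, i ≠ j → (B i).carrier * (B j).carrier = {0})

/-- A completely 0-simple semigroup with finitely many `R`-classes (of itself). -/
def IsFiniteRCompletelyZeroSimple (B : ZeroSubsemigroup S) : Prop :=
  IsCompletelyZeroSimple B.Elem ∧ HasFinitelyManyRClasses B.Elem

/-- `X` is the 0-direct union of finitely many completely 0-simple semigroups that each have
finitely many `R`-classes. -/
def IsFiniteZeroDirectUnionOfCZS (X : Set S) : Prop :=
  ∃ (n : ℕ) (B : Fin n → ZeroSubsemigroup S),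
    IsZeroDirectUnion X B ∧ ∀ i, IsFiniteRCompletelyZeroSimple (B i)

/-- `X` is the 0-direct union of a finite null semigroup `N` and finitely many completely
0-simple semigroups that each have finitely many `R`-classes. The index `none` stands for `N`. -/
def IsFiniteZeroDirectUnionOfNullAndCZS (X : Set S) : Prop :=
  ∃ (N : ZeroSubsemigroup S) (n : ℕ) (B : Fin n → ZeroSubsemigroup S),
    N.carrier.Finite ∧ IsNull N.carrier ∧
    IsZeroDirectUnion X (fun o : Option (Fin n) => o.elim N B) ∧
    ∀ i, IsFiniteRCompletelyZeroSimple (B i)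

end ZeroDirect

section Rees

variable {S : Type*}

/-- The Rees congruence of an ideal `I`: it collapses `I` to one point and nothing else. -/
def reesCon [Semigroup S] (I : Set S) (hI : IsIdeal I) : Con S where
  r a b := a = b ∨ (a ∈ I ∧ b ∈ I)
  iseqv :=
    { refl := fun _ => Or.inl rfl
      symm := by
        rintro a b (rfl | ⟨ha, hb⟩)
        · exact Or.inl rfl
        · exact Or.inr ⟨hb, ha⟩
      trans := by
        rintro a b c (rfl | ⟨ha, hb⟩) (rfl | ⟨hb', hc⟩)
        · exact Or.inl rfl
        · exact Or.inr ⟨hb', hc⟩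
        · exact Or.inr ⟨ha, hb⟩
        · exact Or.inr ⟨ha, hc⟩ }
  mul' := by
    rintro a b c d (rfl | ⟨ha, hb⟩) (rfl | ⟨hc, hd⟩)
    · exact Or.inl rfl
    · exact Or.inr ⟨hI.2.2 _ hc _, hI.2.2 _ hd _⟩
    · exact Or.inr ⟨hI.1.2 _ ha _, hI.1.2 _ hb _⟩
    · exact Or.inr ⟨hI.1.2 _ ha _, hI.1.2 _ hb _⟩

/-- The Rees quotient `S/I`. -/
abbrev ReesQuotient [Semigroup S] (I : Set S) (hI : IsIdeal I) : Type _ :=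
  (reesCon I hI).Quotient

instance [SemigroupWithZero S] (I : Set S) (hI : IsIdeal I) :
    SemigroupWithZero (ReesQuotient I hI) where
  mul_assoc := mul_assoc
  zero := ((0 : S) : (reesCon I hI).Quotient)
  zero_mul a := by
    induction a using Con.induction_on with
    | H a => exact congrArg (fun x : S => (x : (reesCon I hI).Quotient)) (zero_mul a)
  mul_zero a := by
    induction a using Con.induction_on with
    | H a => exact congrArg (fun x : S => (x : (reesCon I hI).Quotient)) (mul_zero a)

end Rees

/-- The right socle is a two-sided ideal. -/
theorem isIdeal_rightSocle (S : Type*) [SemigroupWithZero S] : IsIdeal (rightSocle S) := by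
  have hne : (rightSocle S).Nonempty := ⟨0, Or.inl rfl⟩
  refine ⟨⟨hne, ?_⟩, ⟨hne, ?_⟩⟩
  · rintro a (ha | ⟨R, hR, ha⟩) s
    · rw [Set.mem_singleton_iff] at ha
      exact Or.inl (by simp [ha])
    · exact Or.inr ⟨R, hR, hR.1.2 a ha s⟩
  · rintro a (ha | ⟨R, hR, ha⟩) s
    · rw [Set.mem_singleton_iff] at ha
      exact Or.inl (by simp [ha])
    · by_cases h0 : s * a = 0
      · exact Or.inl h0
      refine Or.inr ⟨(fun r => s * r) '' R, ⟨⟨⟨_, a, ha, rfl⟩, ?_⟩, ?_, ?_⟩, a, ha, rfl⟩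
      · rintro _ ⟨r, hr, rfl⟩ t
        exact ⟨r * t, hR.1.2 r hr t, (mul_assoc s r t).symm⟩
      · intro h
        have : s * a ∈ (fun r => s * r) '' R := ⟨a, ha, rfl⟩
        rw [h] at this
        exact h0 this
      · intro J hJ hJR
        obtain ⟨j, hj⟩ := hJ.1
        obtain ⟨r, hr, hrj⟩ := hJR hj
        have hK : IsRightIdeal {x | x ∈ R ∧ s * x ∈ J} := by
          refine ⟨⟨r, hr, by rw [← hrj] at hj; exact hj⟩, ?_⟩
          rintro x ⟨hx, hx'⟩ t
          exact ⟨hR.1.2 x hx t, by rw [← mul_assoc]; exact hJ.2 _ hx' t⟩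
        rcases hR.2.2 _ hK (fun x hx => hx.1) with h | h
        · left
          ext y
          constructor
          · intro hy
            obtain ⟨x, hx, hxy⟩ := hJR hy
            have hxm : x ∈ {x | x ∈ R ∧ s * x ∈ J} := ⟨hx, by rw [← hxy] at hy; exact hy⟩
            rw [h, Set.mem_singleton_iff] at hxm
            rw [← hxy, hxm]
            simp
          · intro hy
            rw [Set.mem_singleton_iff] at hy
            have := hJ.2 j hj 0
            rw [mul_zero] at this
            rw [hy]
            exact this
        · right
          refine Set.Subset.antisymm hJR ?_
          rintro _ ⟨x, hx, rfl⟩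
          rw [← h] at hx
          exact hx.2

end SocleSemigroup

open scoped Pointwise

/-! The hypothesis `S = Σˡ` is used mainly through left recoverability: if `s p ≠ 0`, then some `u`
satisfies `u s p = p`. Call `a` active if `a S ≠ 0`. The inactive elements form `Aˡ`, and the active
ones together with `0` form `Bˡ`. On active elements, `a S b ≠ 0` is an equivalence relation; each
class with `0` is a subsemigroup, and distinct classes annihilate each other.

If `S` is right noetherian, there are finitely many inactive elements, since they form a finitely
generated right ideal annihilated by `S` on the right. The main point is right division
(`exists_right_div`): if `s` is active and `x s ≠ 0`, then `x s v = x` for some `v`. This comes from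
an `R`-maximal nonzero element of `S x`. Hence each class is completely 0-simple with finitely many
`R`-classes, and there are finitely many classes, which gives (2). For (3), `Σʳ` is the left
annihilator of the inactive elements (`mem_rightSocle_iff`); it consists of the inactive elements
and the classes annihilating them, and the remaining classes make up the Rees quotient.

Conversely, `R`-related elements of a subsemigroup are `R`-related in `S`, and `R`-relations in
`S/Σʳ` between nonzero elements lift to `S`, so (2) and (3) each give (4). Finally (4) leaves only
finitely many right ideals, whence (1). -/

namespace SocleSemigroup

/-! ### Principal right ideals and counting `R`-classes. -/

section PrincipalRightIdeals

variable {S : Type*} [Semigroup S]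

theorem mem_principalRightIdeal_self (a : S) : a ∈ principalRightIdeal a := Or.inl rfl

theorem isRightIdeal_principalRightIdeal (a : S) : IsRightIdeal (principalRightIdeal a) := by
  refine ⟨⟨a, Or.inl rfl⟩, ?_⟩
  rintro x (rfl | ⟨t, rfl⟩) s
  · exact Or.inr ⟨s, rfl⟩
  · exact Or.inr ⟨t * s, mul_assoc _ _ _⟩

theorem IsRightIdeal.principalRightIdeal_subset {I : Set S} (hI : IsRightIdeal I) {a : S}
    (ha : a ∈ I) : principalRightIdeal a ⊆ I := by
  rintro x (rfl | ⟨s, rfl⟩)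
  · exact ha
  · exact hI.2 _ ha s

theorem greenR_iff {a b : S} :
    greenR S a b ↔ a ∈ principalRightIdeal b ∧ b ∈ principalRightIdeal a := by
  constructor
  · intro h
    have h : principalRightIdeal a = principalRightIdeal b := h
    exact ⟨h ▸ mem_principalRightIdeal_self a, h ▸ mem_principalRightIdeal_self b⟩
  · rintro ⟨h, k⟩
    exact Set.Subset.antisymm ((isRightIdeal_principalRightIdeal b).principalRightIdeal_subset h)
      ((isRightIdeal_principalRightIdeal a).principalRightIdeal_subset k)

/-- The set `X` meets only finitely many `R`-classes of `S`, witnessed by representatives. -/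
def MeetsFinitelyManyRClasses (X : Set S) : Prop :=
  ∃ F : Set S, F.Finite ∧ ∀ x ∈ X, ∃ f ∈ F, greenR S f x

theorem MeetsFinitelyManyRClasses.of_finite {X : Set S} (hX : X.Finite) :
    MeetsFinitelyManyRClasses X :=
  ⟨X, hX, fun x hx => ⟨x, hx, (greenR S).refl x⟩⟩

theorem MeetsFinitelyManyRClasses.union {X Y : Set S} (hX : MeetsFinitelyManyRClasses X)
    (hY : MeetsFinitelyManyRClasses Y) : MeetsFinitelyManyRClasses (X ∪ Y) := by
  obtain ⟨F, hF, hFX⟩ := hX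
  obtain ⟨G, hG, hGY⟩ := hY
  refine ⟨F ∪ G, hF.union hG, ?_⟩
  rintro x (hx | hx)
  · obtain ⟨f, hf, h⟩ := hFX x hx
    exact ⟨f, Or.inl hf, h⟩
  · obtain ⟨f, hf, h⟩ := hGY x hx
    exact ⟨f, Or.inr hf, h⟩

theorem MeetsFinitelyManyRClasses.iUnion {ι : Type*} [Finite ι] {X : ι → Set S}
    (hX : ∀ i, MeetsFinitelyManyRClasses (X i)) : MeetsFinitelyManyRClasses (⋃ i, X i) := by
  choose F hF hFX using hX
  refine ⟨⋃ i, F i, Set.finite_iUnion hF, ?_⟩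
  intro x hx
  obtain ⟨i, hi⟩ := Set.mem_iUnion.1 hx
  obtain ⟨f, hf, h⟩ := hFX i x hi
  exact ⟨f, Set.mem_iUnion.2 ⟨i, hf⟩, h⟩

theorem hasFinitelyManyRClasses_iff :
    HasFinitelyManyRClasses S ↔ MeetsFinitelyManyRClasses (Set.univ : Set S) := by
  constructor
  · intro h
    have : Finite (Quotient (greenR S)) := h
    refine ⟨Set.range (Quotient.out : Quotient (greenR S) → S), Set.finite_range _, ?_⟩
    intro x _
    exact ⟨_, ⟨Quotient.mk (greenR S) x, rfl⟩, Quotient.mk_out (s := greenR S) x⟩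
  · rintro ⟨F, hF, h⟩
    have : Finite F := hF
    refine Finite.of_surjective (fun f : F => Quotient.mk (greenR S) (f : S)) ?_
    intro q
    induction q using Quotient.inductionOn with
    | h x =>
      obtain ⟨f, hf, hfx⟩ := h x trivial
      exact ⟨⟨f, hf⟩, Quotient.sound (s := greenR S) hfx⟩

end PrincipalRightIdeals

/-! ### Chain conditions on right ideals. -/

section Noetherian

variable {S : Type*} [Semigroup S]

theorem isRightNoetherian_iff_wellFoundedGT :
    IsRightNoetherian S ↔ WellFoundedGT {I : Set S // IsRightIdeal I} := by
  rw [wellFoundedGT_iff_monotone_chain_condition]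
  constructor
  · intro h a
    obtain ⟨n, hn⟩ := h (fun k => (a k).1) (fun k => (a k).2) (fun i j hij => a.monotone hij)
    exact ⟨n, fun m hm => Subtype.ext (hn m hm).symm⟩
  · intro h I hI hmono
    obtain ⟨n, hn⟩ := h ⟨fun k => ⟨I k, hI k⟩, fun i j hij => hmono hij⟩
    exact ⟨n, fun m hm => (congrArg Subtype.val (hn m hm)).symm⟩

/-- A right ideal is a union of `R`-classes, so it is determined by its image in the finite
quotient; there are only finitely many right ideals. -/
theorem HasFinitelyManyRClasses.isRightNoetherian (h : HasFinitelyManyRClasses S) :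
    IsRightNoetherian S := by
  have : Finite (Quotient (greenR S)) := h
  rw [isRightNoetherian_iff_wellFoundedGT]
  have : Finite {I : Set S // IsRightIdeal I} := by
    refine Finite.of_injective
      (fun I : {I : Set S // IsRightIdeal I} => (Quotient.mk (greenR S)) '' I.1) ?_
    have key : ∀ I J : {I : Set S // IsRightIdeal I},
        (Quotient.mk (greenR S)) '' I.1 = (Quotient.mk (greenR S)) '' J.1 → I.1 ⊆ J.1 := by
      intro I J hIJ x hx
      have hx' : Quotient.mk (greenR S) x ∈ (Quotient.mk (greenR S)) '' J.1 :=
        hIJ ▸ ⟨x, hx, rfl⟩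
      obtain ⟨y, hy, hyx⟩ := hx'
      have hyx : greenR S y x := Quotient.exact (s := greenR S) hyx
      exact J.2.principalRightIdeal_subset hy (greenR_iff.1 hyx).2
    intro I J hIJ
    exact Subtype.ext (Set.Subset.antisymm (key I J hIJ) (key J I hIJ.symm))
  infer_instance

/-- In a right noetherian semigroup every non-empty set has an `R`-maximal element. -/
theorem IsRightNoetherian.exists_maximal (h : IsRightNoetherian S) {M : Set S}
    (hM : M.Nonempty) :
    ∃ m ∈ M, ∀ y ∈ M, m ∈ principalRightIdeal y → y ∈ principalRightIdeal m := by
  rw [isRightNoetherian_iff_wellFoundedGT] at h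
  let f : S → {I : Set S // IsRightIdeal I} :=
    fun a => ⟨principalRightIdeal a, isRightIdeal_principalRightIdeal a⟩
  obtain ⟨_, ⟨m, hm, rfl⟩, hmax⟩ := h.wf.has_min (f '' M) (hM.image f)
  refine ⟨m, hm, fun y hy hmy => ?_⟩
  by_contra hne
  refine hmax (f y) ⟨y, hy, rfl⟩ ?_
  have hle : f m ≤ f y := (isRightIdeal_principalRightIdeal y).principalRightIdeal_subset hmy
  exact lt_of_le_not_ge hle fun hge => hne (hge (mem_principalRightIdeal_self y))

/-- In a right noetherian semigroup every right ideal is finitely generated. -/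
theorem IsRightNoetherian.exists_finite_generators (h : IsRightNoetherian S) {I : Set S}
    (hI : IsRightIdeal I) :
    ∃ F : Set S, F.Finite ∧ F ⊆ I ∧ ∀ x ∈ I, ∃ f ∈ F, x ∈ principalRightIdeal f := by
  rw [isRightNoetherian_iff_wellFoundedGT] at h
  let G : Set {I : Set S // IsRightIdeal I} :=
    {J | ∃ F : Set S, F.Finite ∧ F ⊆ I ∧ J.1 = ⋃ f ∈ F, principalRightIdeal f}
  obtain ⟨a, ha⟩ := hI.1
  have hG : G.Nonempty :=
    ⟨⟨principalRightIdeal a, isRightIdeal_principalRightIdeal a⟩, {a}, Set.finite_singleton a,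
      Set.singleton_subset_iff.2 ha, by simp⟩
  obtain ⟨J, ⟨F, hF, hFI, hJ⟩, hmax⟩ := h.wf.has_min G hG
  refine ⟨F, hF, hFI, fun x hx => ?_⟩
  by_contra hne
  have hxJ : x ∉ J.1 := by
    intro hxJ
    rw [hJ] at hxJ
    simp only [Set.mem_iUnion] at hxJ
    obtain ⟨f, hf, hxf⟩ := hxJ
    exact hne ⟨f, hf, hxf⟩
  have hK : IsRightIdeal (J.1 ∪ principalRightIdeal x) := by
    refine ⟨⟨x, Or.inr (mem_principalRightIdeal_self x)⟩, ?_⟩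
    rintro y (hy | hy) s
    · exact Or.inl (J.2.2 y hy s)
    · exact Or.inr ((isRightIdeal_principalRightIdeal x).2 y hy s)
  refine hmax ⟨_, hK⟩ ⟨insert x F, hF.insert x, Set.insert_subset hx hFI, ?_⟩ ?_
  · simp only [Set.biUnion_insert, hJ]
    exact Set.union_comm _ _
  · have hle : J ≤ ⟨J.1 ∪ principalRightIdeal x, hK⟩ := fun y hy => Or.inl hy
    exact lt_of_le_not_ge hle fun hge => hxJ (hge (Or.inr (mem_principalRightIdeal_self x)))

end Noetherian

/-! ### 0-minimal ideals and left recoverability. -/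

section ZeroMinimal

variable {S : Type*} [SemigroupWithZero S]

theorem IsLeftIdeal.zero_mem {L : Set S} (hL : IsLeftIdeal L) : (0 : S) ∈ L := by
  obtain ⟨a, ha⟩ := hL.1
  simpa using hL.2 a ha 0

theorem IsRightIdeal.zero_mem {R : Set S} (hR : IsRightIdeal R) : (0 : S) ∈ R := by
  obtain ⟨a, ha⟩ := hR.1
  simpa using hR.2 a ha 0

/-- A left ideal contained in a 0-minimal left ideal and containing a non-zero element is all
of it. -/
theorem IsZeroMinimalLeftIdeal.subset_of_mem {L J : Set S} (hL : IsZeroMinimalLeftIdeal L)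
    (hJ : IsLeftIdeal J) (hJL : J ⊆ L) {x : S} (hx : x ∈ J) (hx0 : x ≠ 0) : L ⊆ J := by
  rcases hL.2.2 J hJ hJL with h | h
  · rw [h] at hx
    exact absurd hx hx0
  · exact h.ge

theorem IsZeroMinimalRightIdeal.subset_of_mem {R J : Set S} (hR : IsZeroMinimalRightIdeal R)
    (hJ : IsRightIdeal J) (hJR : J ⊆ R) {x : S} (hx : x ∈ J) (hx0 : x ≠ 0) : R ⊆ J := by
  rcases hR.2.2 J hJ hJR with h | h
  · rw [h] at hx
    exact absurd hx hx0
  · exact h.ge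

variable (S) in
/-- Every `p` can be recovered from a non-zero `s * p` by a left multiplication. This is the
element-wise content of `S` being the union of its 0-minimal left ideals. -/
def IsLeftRecoverable : Prop := ∀ s p : S, s * p ≠ 0 → ∃ u, u * (s * p) = p

/-- If `p` lies in a 0-minimal left ideal `L`, the left ideal generated by `s p ≠ 0` is all of `L`
and so contains `p`. When `p = s p`, the multiplier `s` itself serves. -/
theorem isLeftRecoverable_of_leftSocle_eq_univ (hS : leftSocle S = Set.univ) :
    IsLeftRecoverable S := by
  intro s p hsp
  have hp0 : p ≠ 0 := fun h => hsp (by simp [h])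
  have hp : p ∈ leftSocle S := hS ▸ trivial
  rcases hp with hp | ⟨L, hL, hp⟩
  · exact absurd hp hp0
  have hJ : IsLeftIdeal {x | x = s * p ∨ ∃ u, u * (s * p) = x} := by
    refine ⟨⟨s * p, Or.inl rfl⟩, ?_⟩
    rintro x (rfl | ⟨u, rfl⟩) t
    · exact Or.inr ⟨t, rfl⟩
    · exact Or.inr ⟨t * u, mul_assoc _ _ _⟩
  have hJL : {x | x = s * p ∨ ∃ u, u * (s * p) = x} ⊆ L := by
    rintro x (rfl | ⟨u, rfl⟩)
    · exact hL.1.2 _ hp s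
    · exact hL.1.2 _ (hL.1.2 _ hp s) u
  rcases hL.subset_of_mem hJ hJL (Or.inl rfl) hsp hp with h | h
  · exact ⟨s, by rw [← h]; exact h.symm⟩
  · exact h

end ZeroMinimal

/-! ### Active elements and their link classes. -/

section Classes

variable {S : Type*} [SemigroupWithZero S]

/-- An element that does not annihilate `S` from the left. -/
def IsActive (a : S) : Prop := ∃ s, a * s ≠ 0

/-- `a S b ≠ 0`. -/
def Linked (a b : S) : Prop := ∃ s, a * s * b ≠ 0

theorem IsActive.ne_zero {a : S} (ha : IsActive a) : a ≠ 0 := by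
  rintro rfl
  obtain ⟨s, hs⟩ := ha
  exact hs (zero_mul s)

theorem not_isActive_iff {a : S} : ¬ IsActive a ↔ ∀ s, a * s = 0 := by
  simp [IsActive]

theorem not_isActive_mul {a : S} (ha : ¬ IsActive a) (s : S) : ¬ IsActive (s * a) := by
  rw [not_isActive_iff] at ha ⊢
  intro t
  rw [mul_assoc, ha, mul_zero]

theorem IsActive.of_mul {s a : S} (h : IsActive (s * a)) : IsActive a := by
  by_contra ha
  exact not_isActive_mul ha s h

theorem IsActive.of_mul_right {a s : S} (h : IsActive (a * s)) : IsActive a :=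
  ⟨s, h.ne_zero⟩

theorem IsActive.mul_left (H : IsLeftRecoverable S) {a s : S} (ha : IsActive a)
    (hsa : s * a ≠ 0) : IsActive (s * a) := by
  obtain ⟨u, hu⟩ := H s a hsa
  refine IsActive.of_mul (s := u) ?_
  rwa [hu]

theorem IsActive.linked_self (H : IsLeftRecoverable S) {a : S} (ha : IsActive a) :
    Linked a a := by
  obtain ⟨s, hs⟩ := ha
  obtain ⟨u, hu⟩ := H a s hs
  refine ⟨u, fun h => hs ?_⟩
  rw [← hu, ← mul_assoc, ← mul_assoc, h, zero_mul]

/-- Writing `b = u a s b` inside a nonzero `b w b` exhibits the factor `b (w u) a`, which is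
therefore nonzero. -/
theorem Linked.symm (H : IsLeftRecoverable S) {a b : S} (hb : IsActive b) (h : Linked a b) :
    Linked b a := by
  obtain ⟨s, hs⟩ := h
  obtain ⟨u, hu⟩ := H (a * s) b hs
  obtain ⟨w, hw⟩ := hb.linked_self H
  refine ⟨w * u, fun h0 => hw ?_⟩
  calc b * w * b = b * w * (u * (a * s * b)) := by rw [hu]
    _ = b * (w * u) * a * (s * b) := by simp only [mul_assoc]
    _ = 0 := by rw [h0, zero_mul]

theorem Linked.trans (H : IsLeftRecoverable S) {a b c : S} (hab : Linked a b)
    (hbc : Linked b c) : Linked a c := by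
  obtain ⟨s, hs⟩ := hab
  obtain ⟨t, ht⟩ := hbc
  obtain ⟨u, hu⟩ := H (a * s) b hs
  refine ⟨s * b * t, fun h0 => ht ?_⟩
  calc b * t * c = u * (a * s * b) * t * c := by rw [hu]
    _ = u * (a * (s * b * t) * c) := by simp only [mul_assoc]
    _ = 0 := by rw [h0, mul_zero]

theorem linked_of_mul_ne_zero (H : IsLeftRecoverable S) {a b : S} (hb : IsActive b)
    (h : a * b ≠ 0) : Linked a b := by
  obtain ⟨u, hu⟩ := H a b h
  obtain ⟨w, hw⟩ := hb.linked_self H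
  refine ⟨b * w, fun h0 => hw ?_⟩
  calc b * w * b = u * (a * b) * w * b := by rw [hu]
    _ = u * (a * (b * w) * b) := by simp only [mul_assoc]
    _ = 0 := by rw [h0, mul_zero]

/-- Since `b = u a b`, a nonzero `b w b` forces `a b w b ≠ 0`. A nonzero product thus falls in the
class of its right factor, which makes link classes closed under multiplication. -/
theorem linked_mul_self (H : IsLeftRecoverable S) {a b : S} (hb : IsActive b)
    (h : a * b ≠ 0) : Linked (a * b) b := by
  obtain ⟨u, hu⟩ := H a b h
  obtain ⟨w, hw⟩ := hb.linked_self H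
  refine ⟨w, fun h0 => hw ?_⟩
  calc b * w * b = u * (a * b) * w * b := by rw [hu]
    _ = u * (a * b * w * b) := by simp only [mul_assoc]
    _ = 0 := by rw [h0, mul_zero]

/-- The subsemigroup formed by `0` and the active elements linked to `a`. -/
def linkClass (H : IsLeftRecoverable S) (a : S) : ZeroSubsemigroup S where
  carrier := {x | x = 0 ∨ IsActive x ∧ Linked a x}
  mul_mem' := by
    rintro x y (rfl | ⟨hx, hax⟩) hy
    · exact Or.inl (zero_mul y)
    rcases hy with rfl | ⟨hy, hay⟩
    · exact Or.inl (mul_zero x)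
    by_cases h : x * y = 0
    · exact Or.inl h
    · have hxy := hy.mul_left H h
      exact Or.inr ⟨hxy, hay.trans H ((linked_mul_self H hy h).symm H hy)⟩
  zero_mem' := Or.inl rfl

theorem mem_linkClass {H : IsLeftRecoverable S} {a x : S} :
    x ∈ (linkClass H a).carrier ↔ x = 0 ∨ IsActive x ∧ Linked a x := Iff.rfl

theorem linkClass_eq (H : IsLeftRecoverable S) {a b : S} (hb : IsActive b)
    (h : Linked a b) : linkClass H a = linkClass H b := by
  have : (linkClass H a).carrier = (linkClass H b).carrier := by
    ext x
    rw [mem_linkClass, mem_linkClass]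
    exact or_congr_right (and_congr_right fun _ =>
      ⟨fun hx => (h.symm H hb).trans H hx, fun hx => h.trans H hx⟩)
  cases hA : linkClass H a with
  | mk A hA0 => cases hB : linkClass H b with
    | mk B hB0 =>
      rw [hA, hB] at this
      have : A = B := SetLike.coe_injective this
      subst this
      rfl

end Classes

/-! ### An elementwise criterion for complete 0-simplicity. -/

section Criterion

variable {S : Type*} [SemigroupWithZero S]

/-- Element-wise conditions which make a subsemigroup with zero completely 0-simple with
finitely many `R`-classes. -/
structure HasCZSDivision (T : ZeroSubsemigroup S) : Prop where
  exists_ne_zero : ∃ x ∈ T.carrier, x ≠ 0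
  exists_mul_mul : ∀ x ∈ T.carrier, ∀ y ∈ T.carrier, x ≠ 0 → y ≠ 0 →
    ∃ u ∈ T.carrier, ∃ z ∈ T.carrier, u * x * z = y
  left_div : ∀ s ∈ T.carrier, ∀ x ∈ T.carrier, s * x ≠ 0 → ∃ u ∈ T.carrier, u * (s * x) = x
  right_div : ∀ x ∈ T.carrier, ∀ s ∈ T.carrier, x * s ≠ 0 → ∃ v ∈ T.carrier, x * s * v = x
  finite_cover : ∃ F : Set S, F.Finite ∧ F ⊆ T.carrier ∧ ∀ x ∈ T.carrier, ∃ f ∈ F,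
    x = f ∨ (∃ s ∈ T.carrier, x = f * s) ∧ ∃ t ∈ T.carrier, f = x * t

theorem ZeroSubsemigroup.elem_ne_zero {T : ZeroSubsemigroup S} {x : T.Elem} :
    x ≠ 0 ↔ (x : S) ≠ 0 :=
  not_congr ⟨fun h => congrArg Subtype.val h, fun h => Subtype.ext h⟩

/-- The sandwich condition gives 0-simplicity, and the two division conditions make the one-sided
ideals generated by any nonzero `e` 0-minimal. -/
theorem HasCZSDivision.isFiniteRCompletelyZeroSimple {T : ZeroSubsemigroup S}
    (hT : HasCZSDivision T) : IsFiniteRCompletelyZeroSimple T := by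
  obtain ⟨x₀, hx₀, hx₀0⟩ := hT.exists_ne_zero
  let e : T.Elem := ⟨x₀, hx₀⟩
  have he : e ≠ 0 := ZeroSubsemigroup.elem_ne_zero.2 hx₀0
  refine ⟨⟨⟨?_, ?_⟩, ⟨principalRightIdeal e, isRightIdeal_principalRightIdeal e, ?_, ?_⟩,
    ⟨{y | y = e ∨ ∃ s, y = s * e}, ⟨⟨e, Or.inl rfl⟩, ?_⟩, ?_, ?_⟩⟩, ?_⟩
  · obtain ⟨u, hu, z, hz, h⟩ := hT.exists_mul_mul x₀ hx₀ x₀ hx₀ hx₀0 hx₀0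
    refine ⟨⟨u, hu⟩, e, ZeroSubsemigroup.elem_ne_zero.2 fun h0 => hx₀0 ?_⟩
    have h0 : u * x₀ = 0 := h0
    rw [← h, h0, zero_mul]
  · intro I hI
    by_cases h : I = {0}
    · exact Or.inl h
    right
    have : ∃ x ∈ I, x ≠ 0 := by
      by_contra! hne
      exact h (Set.Subset.antisymm hne (Set.singleton_subset_iff.2 hI.1.zero_mem))
    obtain ⟨x, hx, hx0⟩ := this
    refine Set.eq_univ_of_forall fun y => ?_
    by_cases hy : y = 0
    · rw [hy]
      exact hI.1.zero_mem
    obtain ⟨u, hu, z, hz, h⟩ := hT.exists_mul_mul x x.2 y y.2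
      (ZeroSubsemigroup.elem_ne_zero.1 hx0) (ZeroSubsemigroup.elem_ne_zero.1 hy)
    have hy' : y = (⟨u, hu⟩ : T.Elem) * x * ⟨z, hz⟩ := Subtype.ext h.symm
    rw [hy']
    exact hI.1.2 _ (hI.2.2 _ hx _) _
  · intro h
    exact he (h ▸ mem_principalRightIdeal_self e : e ∈ ({0} : Set T.Elem))
  · intro J hJ hJe
    by_cases h : J = {0}
    · exact Or.inl h
    right
    have : ∃ x ∈ J, x ≠ 0 := by
      by_contra! hne
      exact h (Set.Subset.antisymm hne (Set.singleton_subset_iff.2 hJ.zero_mem))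
    obtain ⟨x, hx, hx0⟩ := this
    refine Set.Subset.antisymm hJe (hJ.principalRightIdeal_subset ?_)
    rcases hJe hx with rfl | ⟨s, rfl⟩
    · exact hx
    obtain ⟨v, hv, h⟩ := hT.right_div x₀ hx₀ s s.2 (ZeroSubsemigroup.elem_ne_zero.1 hx0)
    have he' : e = e * s * ⟨v, hv⟩ := Subtype.ext h.symm
    rw [he']
    exact hJ.2 _ hx _
  · rintro x (rfl | ⟨t, rfl⟩) s
    · exact Or.inr ⟨s, rfl⟩
    · exact Or.inr ⟨s * t, (mul_assoc _ _ _).symm⟩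
  · intro h
    have : e ∈ ({0} : Set T.Elem) := h ▸ Or.inl rfl
    exact he this
  · intro J hJ hJe
    by_cases h : J = {0}
    · exact Or.inl h
    right
    have : ∃ x ∈ J, x ≠ 0 := by
      by_contra! hne
      exact h (Set.Subset.antisymm hne (Set.singleton_subset_iff.2 hJ.zero_mem))
    obtain ⟨x, hx, hx0⟩ := this
    have heJ : e ∈ J := by
      rcases hJe hx with rfl | ⟨s, rfl⟩
      · exact hx
      obtain ⟨v, hv, h⟩ := hT.left_div s s.2 x₀ hx₀ (ZeroSubsemigroup.elem_ne_zero.1 hx0)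
      have he' : e = ⟨v, hv⟩ * (s * e) := Subtype.ext h.symm
      rw [he']
      exact hJ.2 _ hx _
    refine Set.Subset.antisymm hJe ?_
    rintro y (rfl | ⟨s, rfl⟩)
    · exact heJ
    · exact hJ.2 _ heJ s
  · rw [hasFinitelyManyRClasses_iff]
    obtain ⟨F, hF, hFT, h⟩ := hT.finite_cover
    refine ⟨Subtype.val ⁻¹' F, hF.preimage Subtype.val_injective.injOn, fun x _ => ?_⟩
    obtain ⟨f, hf, hxf⟩ := h x x.2
    refine ⟨⟨f, hFT hf⟩, hf, greenR_iff.2 ?_⟩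
    rcases hxf with hxf | ⟨⟨s, hs, hxs⟩, t, ht, hft⟩
    · exact ⟨Or.inl (Subtype.ext hxf.symm), Or.inl (Subtype.ext hxf)⟩
    · exact ⟨Or.inr ⟨⟨t, ht⟩, Subtype.ext hft⟩, Or.inr ⟨⟨s, hs⟩, Subtype.ext hxs⟩⟩

variable {M : Type*} [SemigroupWithZero M]

/-- The image of a subsemigroup with zero under a zero-preserving homomorphism. -/
def ZeroSubsemigroup.map (f : S →ₙ* M) (hf : f 0 = 0) (T : ZeroSubsemigroup S) :
    ZeroSubsemigroup M where
  toSubsemigroup := T.toSubsemigroup.map f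
  zero_mem' := ⟨0, T.zero_mem', hf⟩

/-- Every condition asks for witnesses under nonvanishing hypotheses, so a trivial kernel on `T`
suffices and injectivity is not needed. -/
theorem HasCZSDivision.map {T : ZeroSubsemigroup S} (hT : HasCZSDivision T) (f : S →ₙ* M)
    (hf : f 0 = 0) (hker : ∀ x ∈ T.carrier, f x = 0 → x = 0) : HasCZSDivision (T.map f hf) where
  exists_ne_zero := by
    obtain ⟨x, hx, hx0⟩ := hT.exists_ne_zero
    exact ⟨f x, ⟨x, hx, rfl⟩, fun h => hx0 (hker x hx h)⟩
  exists_mul_mul := by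
    rintro _ ⟨x, hx, rfl⟩ _ ⟨y, hy, rfl⟩ hx0 hy0
    obtain ⟨u, hu, z, hz, h⟩ := hT.exists_mul_mul x hx y hy
      (fun h => hx0 (by rw [h, hf])) (fun h => hy0 (by rw [h, hf]))
    exact ⟨f u, ⟨u, hu, rfl⟩, f z, ⟨z, hz, rfl⟩, by rw [← map_mul, ← map_mul, h]⟩
  left_div := by
    rintro _ ⟨s, hs, rfl⟩ _ ⟨x, hx, rfl⟩ h0
    obtain ⟨u, hu, h⟩ := hT.left_div s hs x hx (fun h => h0 (by rw [← map_mul, h, hf]))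
    exact ⟨f u, ⟨u, hu, rfl⟩, by rw [← map_mul, ← map_mul, h]⟩
  right_div := by
    rintro _ ⟨x, hx, rfl⟩ _ ⟨s, hs, rfl⟩ h0
    obtain ⟨u, hu, h⟩ := hT.right_div x hx s hs (fun h => h0 (by rw [← map_mul, h, hf]))
    exact ⟨f u, ⟨u, hu, rfl⟩, by rw [← map_mul, ← map_mul, h]⟩
  finite_cover := by
    obtain ⟨F, hF, hFT, h⟩ := hT.finite_cover
    refine ⟨f '' F, hF.image f, ?_, ?_⟩
    · rintro _ ⟨x, hx, rfl⟩
      exact ⟨x, hFT hx, rfl⟩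
    · rintro _ ⟨x, hx, rfl⟩
      obtain ⟨g, hg, hxg⟩ := h x hx
      refine ⟨f g, ⟨g, hg, rfl⟩, ?_⟩
      rcases hxg with rfl | ⟨⟨s, hs, hxs⟩, t, ht, hgt⟩
      · exact Or.inl rfl
      · exact Or.inr ⟨⟨f s, ⟨s, hs, rfl⟩, by rw [← map_mul, ← hxs]⟩,
          f t, ⟨t, ht, rfl⟩, by rw [← map_mul, ← hgt]⟩

end Criterion

/-! ### Right division from the noetherian condition. -/

section Stability

variable {S : Type*} [SemigroupWithZero S]

/-- If `S` is right noetherian and `x * r ≠ 0` with `r ∈ S x`, then right multiplication by `r`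
has a one-sided inverse at `x` lying in `S x`. -/
theorem exists_mul_mul_eq_self (H : IsLeftRecoverable S) (hN : IsRightNoetherian S) {x r : S}
    (hr : ∃ a, r = a * x) (hxr : x * r ≠ 0) : ∃ t, (∃ a, t = a * x) ∧ x * t * r = x := by
  obtain ⟨a, ha⟩ := hr
  have hx0 : x ≠ 0 := fun h => hxr (by simp [h])
  have hr0 : r ≠ 0 := fun h => hxr (by simp [h])
  obtain ⟨b, hb⟩ := H a x (ha ▸ hr0)
  rw [← ha] at hb
  -- Choose `m = c x` to be `R`-maximal among the nonzero elements of `S x`; then `v m = x` lets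
  -- identities at `m` be carried back to `x`.
  obtain ⟨m, ⟨⟨c, hc⟩, hm0⟩, hmax⟩ := hN.exists_maximal
    (M := {y | (∃ u, y = u * x) ∧ y ≠ 0}) ⟨r, ⟨a, ha⟩, hr0⟩
  obtain ⟨v, hv⟩ := H c x (hc ▸ hm0)
  rw [← hc] at hv
  have hmr : m * r ≠ 0 := by
    intro h
    apply hxr
    rw [← hv, mul_assoc, h, mul_zero]
  obtain ⟨u, hu⟩ := H m r hmr
  have hm' : c * b * u * m * r = m := by
    calc c * b * u * m * r = c * (b * (u * (m * r))) := by simp only [mul_assoc]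
      _ = m := by rw [hu, hb, hc]
  -- The element `y = c b u m` lies in `S x` and satisfies `y r = m`, so maximality yields `y = m`
  -- or `y = m t`. If `y = m`, then `m r = m` and `t = r` works.
  have key : ∃ t, (∃ d, m * t = d * x) ∧ m * t * r = m := by
    rcases hmax (c * b * u * m) ⟨⟨c * b * u * c, by simp only [hc, mul_assoc]⟩, fun h0 => hm0 (by
      rw [← hm', h0, zero_mul])⟩ (Or.inr ⟨r, hm'.symm⟩) with h | ⟨t, ht⟩
    · rw [h] at hm'
      exact ⟨r, ⟨c, by rw [hm', hc]⟩, by rw [hm', hm']⟩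
    · exact ⟨t, ⟨c * b * u * c, by rw [← ht]; simp only [hc, mul_assoc]⟩, by rw [← ht, hm']⟩
  obtain ⟨t, ⟨d, hd⟩, hmt⟩ := key
  have hmt0 : m * t ≠ 0 := fun h => hm0 (by rw [← hmt, h, zero_mul])
  obtain ⟨k, hk⟩ := H m t hmt0
  refine ⟨t, ⟨k * d, by rw [mul_assoc, ← hd, hk]⟩, ?_⟩
  calc x * t * r = v * (m * t * r) := by rw [← hv]; simp only [mul_assoc]
    _ = x := by rw [hmt, hv]

/-- The usual comparison of one-sided inverses: from `x t r = x` and `x w t = x` with `w ∈ S x`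
follows `x r = x w t r = x w`, so `t` also inverts `r` from the other side. -/
theorem exists_right_inverse (H : IsLeftRecoverable S) (hN : IsRightNoetherian S) {x r : S}
    (hr : ∃ a, r = a * x) (hxr : x * r ≠ 0) : ∃ t, x * r * t = x := by
  have hx0 : x ≠ 0 := fun h => hxr (by simp [h])
  obtain ⟨t, ht, h₁⟩ := exists_mul_mul_eq_self H hN hr hxr
  have hxt : x * t ≠ 0 := fun h => hx0 (by rw [← h₁, h, zero_mul])
  obtain ⟨w, ⟨a, hw⟩, h₂⟩ := exists_mul_mul_eq_self H hN ht hxt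
  have h₃ : x * r = x * w := by
    calc x * r = x * w * t * r := by rw [h₂]
      _ = x * a * (x * t * r) := by rw [hw]; simp only [mul_assoc]
      _ = x * w := by rw [h₁, hw, mul_assoc]
  exact ⟨t, by rw [h₃, h₂]⟩

/-- In the right noetherian case, active elements below `x` in the `R`-order are `R`-related
to `x`. -/
theorem exists_right_div (H : IsLeftRecoverable S) (hN : IsRightNoetherian S) {x s : S}
    (hs : IsActive s) (hxs : x * s ≠ 0) :
    ∃ v, IsActive v ∧ Linked x v ∧ x * s * v = x := by
  have hx : IsActive x := ⟨s, hxs⟩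
  obtain ⟨w, hw⟩ := (linked_of_mul_ne_zero H hs hxs).symm H hs
  obtain ⟨u, hu⟩ := H x s hxs
  -- The multiplier `s` need not lie in `S x`, but `s w x` does; inverting it at `x` by `t` gives `v
  -- = w x t`.
  have hne : x * (s * w * x) ≠ 0 := by
    intro h
    apply hw
    calc s * w * x = u * (x * s) * w * x := by rw [hu]
      _ = u * (x * (s * w * x)) := by simp only [mul_assoc]
      _ = 0 := by rw [h, mul_zero]
  obtain ⟨t, ht⟩ := exists_right_inverse H hN ⟨s * w, rfl⟩ hne
  have hv : x * s * (w * x * t) = x := by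
    simpa only [mul_assoc] using ht
  have hact : IsActive (w * x * t) := by
    refine IsActive.of_mul (s := x * s) ?_
    rwa [hv]
  obtain ⟨z, hz⟩ := linked_of_mul_ne_zero H hact (hv.symm ▸ hx.ne_zero : x * s * (w * x * t) ≠ 0)
  exact ⟨w * x * t, hact, ⟨s * z, by rwa [← mul_assoc x s z]⟩, hv⟩

end Stability

/-! ### The null and idempotent parts, and finiteness in the noetherian case. -/

section Parts

variable {S : Type*} [SemigroupWithZero S]

/-- If `u a p = p`, then `p = (u a)(u a) p`, and `(u a)(u a)` vanishes because `u a ∈ L`. -/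
theorem not_isActive_of_mem_null {L : Set S} (H : IsLeftRecoverable S) (hL : IsLeftIdeal L)
    (hnull : IsNull L) {a : S} (ha : a ∈ L) : ¬ IsActive a := by
  rintro ⟨p, hp⟩
  obtain ⟨u, hu⟩ := H a p hp
  have hua : u * a ∈ L := hL.2 a ha u
  have h0 : u * a * (u * a) ∈ L * L := Set.mul_mem_mul hua hua
  rw [hnull, Set.mem_singleton_iff] at h0
  have h : p = 0 := by
    calc p = u * (a * (u * (a * p))) := by rw [hu, hu]
      _ = u * a * (u * a) * p := by simp only [mul_assoc]
      _ = 0 := by rw [h0, zero_mul]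
  exact hp (by rw [h, mul_zero])

theorem mem_leftNullPart_iff (hS : leftSocle S = Set.univ) {a : S} :
    a ∈ leftNullPart S ↔ ¬ IsActive a := by
  have H := isLeftRecoverable_of_leftSocle_eq_univ hS
  constructor
  · rintro (ha | ⟨L, ⟨hL, hnull⟩, ha⟩)
    · rw [Set.mem_singleton_iff] at ha
      exact fun h => h.ne_zero ha
    · exact not_isActive_of_mem_null H hL.1 hnull ha
  · intro ha
    have haS : a ∈ leftSocle S := hS ▸ trivial
    rcases haS with h0 | ⟨L, hL, haL⟩
    · exact Or.inl h0
    by_cases ha0 : a = 0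
    · exact Or.inl ha0
    have hJ : IsLeftIdeal {x | x ∈ L ∧ ¬ IsActive x} :=
      ⟨⟨a, haL, ha⟩, fun x hx s => ⟨hL.1.2 x hx.1 s, not_isActive_mul hx.2 s⟩⟩
    have hLJ := hL.subset_of_mem hJ (fun x hx => hx.1) ⟨haL, ha⟩ ha0
    refine Or.inr ⟨L, ⟨hL, Set.Subset.antisymm ?_ ?_⟩, haL⟩
    · rintro _ ⟨x, hx, y, hy, rfl⟩
      exact not_isActive_iff.1 (hLJ hx).2 y
    · exact Set.singleton_subset_iff.2 ⟨0, hL.1.zero_mem, 0, hL.1.zero_mem, zero_mul 0⟩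

theorem mem_leftIdempotentPart_iff (hS : leftSocle S = Set.univ) {b : S} :
    b ∈ leftIdempotentPart S ↔ b = 0 ∨ IsActive b := by
  constructor
  · rintro (hb | ⟨L, ⟨hL, hidem⟩, hb⟩)
    · exact Or.inl hb
    by_cases hb0 : b = 0
    · exact Or.inl hb0
    right
    by_contra hact
    have hJ : IsLeftIdeal {x | x ∈ L ∧ ¬ IsActive x} :=
      ⟨⟨b, hb, hact⟩, fun x hx s => ⟨hL.1.2 x hx.1 s, not_isActive_mul hx.2 s⟩⟩
    have hLJ := hL.subset_of_mem hJ (fun x hx => hx.1) ⟨hb, hact⟩ hb0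
    have hbL : b ∈ L * L := by rwa [hidem]
    obtain ⟨x, hx, y, hy, hxy⟩ := hbL
    exact hb0 (hxy.symm.trans (not_isActive_iff.1 (hLJ hx).2 y))
  · rintro (hb | hb)
    · exact Or.inl hb
    have hbS : b ∈ leftSocle S := hS ▸ trivial
    rcases hbS with h0 | ⟨L, hL, hbL⟩
    · exact Or.inl h0
    refine Or.inr ⟨L, ⟨hL, ?_⟩, hbL⟩
    have hLL : IsLeftIdeal (L * L) := by
      refine ⟨⟨b * b, Set.mul_mem_mul hbL hbL⟩, ?_⟩
      rintro _ ⟨x, hx, y, hy, rfl⟩ s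
      exact ⟨s * x, hL.1.2 x hx s, y, hy, mul_assoc s x y⟩
    have hsub : L * L ⊆ L := by
      rintro _ ⟨x, hx, y, hy, rfl⟩
      exact hL.1.2 y hy x
    rcases hL.2.2 _ hLL hsub with h | h
    · exact absurd hb ((mem_leftNullPart_iff hS).1 (Or.inr ⟨L, ⟨hL, h⟩, hbL⟩))
    · exact h

/-- The inactive elements form a right ideal in which right multiplication gives only `0`, so a
finite generating set together with `0` exhausts it. -/
theorem IsRightNoetherian.finite_not_isActive (hN : IsRightNoetherian S) :
    {a : S | ¬ IsActive a}.Finite := by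
  have hI : IsRightIdeal {a : S | ¬ IsActive a} := by
    refine ⟨⟨0, fun h => h.ne_zero rfl⟩, fun a ha s h => ?_⟩
    exact ha h.of_mul_right
  obtain ⟨F, hF, hFI, h⟩ := hN.exists_finite_generators hI
  refine (hF.insert 0).subset fun x hx => ?_
  obtain ⟨f, hf, rfl | ⟨s, rfl⟩⟩ := h x hx
  · exact Or.inr hf
  · exact Or.inl (not_isActive_iff.1 (hFI hf) s)

/-- In the right noetherian case the active elements lie in finitely many `R`-classes. -/
theorem IsRightNoetherian.exists_finite_active (H : IsLeftRecoverable S)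
    (hN : IsRightNoetherian S) :
    ∃ F : Set S, F.Finite ∧ ∀ x, IsActive x → ∃ f ∈ F, IsActive f ∧ Linked f x ∧
      (x = f ∨ (∃ s, IsActive s ∧ Linked f s ∧ x = f * s) ∧
        ∃ t, IsActive t ∧ Linked f t ∧ f = x * t) := by
  obtain ⟨F, hF, -, h⟩ := hN.exists_finite_generators (I := (Set.univ : Set S))
    ⟨⟨0, trivial⟩, fun _ _ _ => trivial⟩
  refine ⟨F, hF, fun x hx => ?_⟩
  obtain ⟨f, hf, rfl | ⟨s, rfl⟩⟩ := h x trivial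
  · exact ⟨x, hf, hx, hx.linked_self H, Or.inl rfl⟩
  have hs : IsActive s := hx.of_mul
  have hfs := linked_of_mul_ne_zero H hs hx.ne_zero
  obtain ⟨v, hv, hfv, hfsv⟩ := exists_right_div H hN hs hx.ne_zero
  exact ⟨f, hf, hx.of_mul_right, hfs.trans H ((linked_mul_self H hs hx.ne_zero).symm H hs),
    Or.inr ⟨⟨s, hs, hfs, rfl⟩, v, hv, hfv, hfsv.symm⟩⟩

/-- Only right division and the finite cover need the noetherian condition; the other conditions
come from left recoverability. The remaining work is to place the witnesses inside the class. -/
theorem hasCZSDivision_linkClass (H : IsLeftRecoverable S) (hN : IsRightNoetherian S) {a : S}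
    (ha : IsActive a) : HasCZSDivision (linkClass H a) where
  exists_ne_zero := ⟨a, Or.inr ⟨ha, ha.linked_self H⟩, ha.ne_zero⟩
  exists_mul_mul := by
    rintro x (hx0 | ⟨hx, hax⟩) y (hy0 | ⟨hy, hay⟩) hx0' hy0'
    · exact absurd hx0 hx0'
    · exact absurd hx0 hx0'
    · exact absurd hy0 hy0'
    -- This `z` need not belong to the class. Since `u x z y = y`, the right-hand witness is taken
    -- to be `z y`, which does.
    obtain ⟨z, hz⟩ := (hax.symm H hx).trans H hay
    obtain ⟨u, hu⟩ := H (x * z) y hz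
    have hzy : z * y ≠ 0 := fun h => hz (by rw [mul_assoc, h, mul_zero])
    have hux : u * x ≠ 0 := fun h => hy0' (by
      rw [← hu, ← mul_assoc, ← mul_assoc, h, zero_mul, zero_mul])
    have hu' := linked_of_mul_ne_zero H hx hux
    have hact : IsActive u := ⟨x, hux⟩
    exact ⟨u, Or.inr ⟨hact, hax.trans H (hu'.symm H hx)⟩, z * y,
      Or.inr ⟨hy.mul_left H hzy, hay.trans H ((linked_mul_self H hy hzy).symm H hy)⟩,
      by simpa only [mul_assoc] using hu⟩
  left_div := by
    rintro s hs x (rfl | ⟨hx, hax⟩) hsx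
    · exact absurd (mul_zero s) hsx
    obtain ⟨u, hu⟩ := H s x hsx
    have hux : u * (s * x) ≠ 0 := hu.symm ▸ hx.ne_zero
    have hsx' := hx.mul_left H hsx
    have h := (linked_of_mul_ne_zero H hsx' hux).trans H (linked_mul_self H hx hsx)
    exact ⟨u, Or.inr ⟨⟨_, hux⟩, hax.trans H (h.symm H hx)⟩, hu⟩
  right_div := by
    rintro x (rfl | ⟨hx, hax⟩) s (rfl | ⟨hs, has⟩) hxs
    · exact absurd (zero_mul _) hxs
    · exact absurd (zero_mul _) hxs
    · exact absurd (mul_zero _) hxs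
    obtain ⟨v, hv, hxv, h⟩ := exists_right_div H hN hs hxs
    exact ⟨v, Or.inr ⟨hv, hax.trans H hxv⟩, h⟩
  finite_cover := by
    obtain ⟨F, hF, h⟩ := hN.exists_finite_active H
    refine ⟨insert 0 F ∩ (linkClass H a).carrier, (hF.insert 0).inter_of_left _,
      Set.inter_subset_right, ?_⟩
    rintro x (rfl | ⟨hx, hax⟩)
    · exact ⟨0, ⟨Or.inl rfl, Or.inl rfl⟩, Or.inl rfl⟩
    obtain ⟨f, hf, hfa, hfx, hcase⟩ := h x hx
    have haf : Linked a f := hax.trans H (hfx.symm H hx)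
    refine ⟨f, ⟨Or.inr hf, Or.inr ⟨hfa, haf⟩⟩, ?_⟩
    rcases hcase with hxf | ⟨⟨s, hs, hfs, hxs⟩, t, ht, hft, hxt⟩
    · exact Or.inl hxf
    · exact Or.inr ⟨⟨s, Or.inr ⟨hs, haf.trans H hfs⟩, hxs⟩,
        t, Or.inr ⟨ht, haf.trans H hft⟩, hxt⟩

end Parts

/-! ### 0-direct decompositions of `Bˡ`, `Σʳ` and `S/Σʳ`. -/

section Decomposition

variable {S : Type*} [SemigroupWithZero S]

/-- The classes of linked active elements satisfying `Q`. -/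
abbrev LinkClasses (H : IsLeftRecoverable S) (Q : S → Prop) : Type _ :=
  {T : ZeroSubsemigroup S // ∃ a, IsActive a ∧ Q a ∧ T = linkClass H a}

theorem finite_linkClasses (H : IsLeftRecoverable S) (hN : IsRightNoetherian S) (Q : S → Prop) :
    Finite (LinkClasses H Q) := by
  obtain ⟨F, hF, h⟩ := hN.exists_finite_active H
  refine Set.Finite.subset (hF.image (linkClass H)) ?_
  rintro T ⟨a, ha, -, rfl⟩
  obtain ⟨f, hf, hfa, hfx, -⟩ := h a ha
  exact ⟨f, hf, linkClass_eq H ha hfx⟩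

theorem linkClasses_inter (H : IsLeftRecoverable S) {Q : S → Prop} {i j : LinkClasses H Q}
    (hij : i ≠ j) {x : S} (hi : x ∈ i.1.carrier) (hj : x ∈ j.1.carrier) : x = 0 := by
  obtain ⟨a, -, -, hia⟩ := i.2
  obtain ⟨b, hb, -, hjb⟩ := j.2
  rw [hia] at hi
  rw [hjb] at hj
  rcases hi with hx | ⟨hx, hax⟩
  · exact hx
  rcases hj with hx' | ⟨-, hbx⟩
  · exact hx'
  have h := hax.trans H (hbx.symm H hx)
  exact absurd (Subtype.ext (hia.trans ((linkClass_eq H hb h).trans hjb.symm))) hij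

theorem linkClasses_mul (H : IsLeftRecoverable S) {Q : S → Prop} {i j : LinkClasses H Q}
    (hij : i ≠ j) {x y : S} (hi : x ∈ i.1.carrier) (hj : y ∈ j.1.carrier) : x * y = 0 := by
  obtain ⟨a, -, -, hia⟩ := i.2
  obtain ⟨b, hb, -, hjb⟩ := j.2
  rw [hia] at hi
  rw [hjb] at hj
  rcases hi with rfl | ⟨hx, hax⟩
  · exact zero_mul y
  rcases hj with rfl | ⟨hy, hby⟩
  · exact mul_zero x
  by_contra hxy
  have h := (hax.trans H (linked_of_mul_ne_zero H hy hxy)).trans H (hby.symm H hy)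
  exact absurd (Subtype.ext (hia.trans ((linkClass_eq H hb h).trans hjb.symm))) hij

/-- The index type guarantees `Q` only at one representative, so `Q` has to be invariant under
linking. -/
theorem mem_iUnion_linkClasses (H : IsLeftRecoverable S) {Q : S → Prop}
    (hQ : ∀ a x, IsActive x → Linked a x → Q a → Q x) {x : S} (hx0 : x ≠ 0) :
    (∃ i : LinkClasses H Q, x ∈ i.1.carrier) ↔ IsActive x ∧ Q x := by
  constructor
  · rintro ⟨⟨_, a, ha, hQa, rfl⟩, hx | ⟨hx, hax⟩⟩
    · exact absurd hx hx0
    · exact ⟨hx, hQ a x hx hax hQa⟩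
  · rintro ⟨hx, hQx⟩
    exact ⟨⟨_, x, hx, hQx, rfl⟩, Or.inr ⟨hx, hx.linked_self H⟩⟩

/-- A pairwise criterion for 0-direct unions in which only the inclusions into `0` are left to
check. -/
theorem isZeroDirectUnion_of {ι : Type*} {X : Set S} {B : ι → ZeroSubsemigroup S}
    (hX : ∀ x, x ∈ X ↔ ∃ i, x ∈ (B i).carrier)
    (hinter : ∀ i j, i ≠ j → ∀ x ∈ (B i).carrier, x ∈ (B j).carrier → x = 0)
    (hmul : ∀ i j, i ≠ j → ∀ x ∈ (B i).carrier, ∀ y ∈ (B j).carrier, x * y = 0) :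
    IsZeroDirectUnion X B := by
  refine ⟨?_, fun i j hij => Set.Subset.antisymm ?_ ?_, fun i j hij => Set.Subset.antisymm ?_ ?_⟩
  · ext x
    rw [hX, Set.mem_iUnion]
  · rintro x ⟨hi, hj⟩
    exact hinter i j hij x hi hj
  · exact Set.singleton_subset_iff.2 ⟨(B i).zero_mem', (B j).zero_mem'⟩
  · rintro _ ⟨x, hx, y, hy, rfl⟩
    exact hmul i j hij x hx y hy
  · exact Set.singleton_subset_iff.2 ⟨0, (B i).zero_mem', 0, (B j).zero_mem', zero_mul 0⟩

theorem isFiniteZeroDirectUnionOfCZS_of_finite {κ : Type*} [Finite κ] {X : Set S}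
    {B : κ → ZeroSubsemigroup S} (hX : ∀ x, x ∈ X ↔ ∃ i, x ∈ (B i).carrier)
    (hinter : ∀ i j, i ≠ j → ∀ x ∈ (B i).carrier, x ∈ (B j).carrier → x = 0)
    (hmul : ∀ i j, i ≠ j → ∀ x ∈ (B i).carrier, ∀ y ∈ (B j).carrier, x * y = 0)
    (hB : ∀ i, HasCZSDivision (B i)) : IsFiniteZeroDirectUnionOfCZS X := by
  let e := Finite.equivFin κ
  refine ⟨Nat.card κ, fun i => B (e.symm i), isZeroDirectUnion_of (fun x => ?_)
    (fun i j hij => hinter _ _ (e.symm.injective.ne hij))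
    (fun i j hij => hmul _ _ (e.symm.injective.ne hij)),
    fun i => (hB _).isFiniteRCompletelyZeroSimple⟩
  rw [hX, e.symm.exists_congr_left]
  simp

theorem LinkClasses.hasCZSDivision (H : IsLeftRecoverable S) (hN : IsRightNoetherian S)
    {Q : S → Prop} (i : LinkClasses H Q) : HasCZSDivision i.1 := by
  obtain ⟨_, a, ha, -, rfl⟩ := i
  exact hasCZSDivision_linkClass H hN ha

theorem isFiniteZeroDirectUnionOfCZS_leftIdempotentPart (hS : leftSocle S = Set.univ)
    (hN : IsRightNoetherian S) (h0 : leftIdempotentPart S ≠ {0}) :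
    IsFiniteZeroDirectUnionOfCZS (leftIdempotentPart S) := by
  have H := isLeftRecoverable_of_leftSocle_eq_univ hS
  have := finite_linkClasses H hN fun _ => True
  -- At least one class is needed, since an empty union would miss `0`.
  obtain ⟨b, hb⟩ : ∃ b : S, IsActive b := by
    by_contra! hne
    refine h0 (Set.Subset.antisymm (fun x hx => ?_) (Set.singleton_subset_iff.2 (Or.inl rfl)))
    exact ((mem_leftIdempotentPart_iff hS).1 hx).resolve_right (hne x)
  refine isFiniteZeroDirectUnionOfCZS_of_finite
    (B := fun i : LinkClasses H fun _ => True => i.1) (fun x => ?_)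
    (fun i j hij x => linkClasses_inter H hij)
    (fun i j hij x hx y => linkClasses_mul H hij hx) (LinkClasses.hasCZSDivision H hN)
  rw [mem_leftIdempotentPart_iff hS]
  by_cases hx : x = 0
  · subst hx
    exact ⟨fun _ => ⟨⟨_, b, hb, trivial, rfl⟩, Or.inl rfl⟩, fun _ => Or.inl rfl⟩
  · rw [mem_iUnion_linkClasses H (fun _ _ _ _ h => h) hx]
    simp [hx]

/-- `x` annihilates the inactive elements from the left. -/
def KillsInactive (x : S) : Prop := ∀ c, ¬ IsActive c → x * c = 0

/-- Write `x = u a w x`; then `w x c` is again inactive, so `a` annihilates it. -/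
theorem KillsInactive.of_linked (H : IsLeftRecoverable S) {a x : S} (hax : Linked a x)
    (ha : KillsInactive a) : KillsInactive x := by
  intro c hc
  obtain ⟨w, hw⟩ := hax
  obtain ⟨u, hu⟩ := H (a * w) x hw
  calc x * c = u * (a * w * x) * c := by rw [hu]
    _ = u * (a * (w * x * c)) := by simp only [mul_assoc]
    _ = 0 := by rw [ha _ (not_isActive_mul hc _), mul_zero]

/-- In the right noetherian case `Σʳ` is the left annihilator of the inactive elements. -/
theorem mem_rightSocle_iff (H : IsLeftRecoverable S) (hN : IsRightNoetherian S) {x : S} :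
    x ∈ rightSocle S ↔ KillsInactive x := by
  constructor
  · rintro (hx | ⟨R, hR, hx⟩) c hc
    · rw [Set.mem_singleton_iff] at hx
      rw [hx, zero_mul]
    by_contra hxc
    have hact := not_isActive_mul hc x
    have hJ : IsRightIdeal {y | y = x * c ∨ y = 0} := by
      refine ⟨⟨0, Or.inr rfl⟩, ?_⟩
      rintro y (rfl | rfl) s
      · exact Or.inr (not_isActive_iff.1 hact s)
      · exact Or.inr (zero_mul s)
    -- By 0-minimality `R = {x c, 0}`, so `x = x c` would be inactive although `x c ≠ 0`.
    have hJR : {y | y = x * c ∨ y = 0} ⊆ R := by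
      rintro y (rfl | rfl)
      · exact hR.1.2 x hx c
      · exact hR.1.zero_mem
    rcases hR.subset_of_mem hJ hJR (Or.inl rfl) hxc hx with h | h
    · rw [← h] at hact
      exact hact ⟨c, hxc⟩
    · exact hxc (by rw [h, zero_mul])
  · intro hx
    by_cases hx0 : x = 0
    · exact Or.inl hx0
    refine Or.inr ⟨principalRightIdeal x, ⟨isRightIdeal_principalRightIdeal x, fun h => hx0 ?_, ?_⟩,
      mem_principalRightIdeal_self x⟩
    · have := mem_principalRightIdeal_self x
      rwa [h] at this
    intro J hJ hJx
    by_cases h : J = {0}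
    · exact Or.inl h
    right
    have : ∃ y ∈ J, y ≠ 0 := by
      by_contra! hne
      exact h (Set.Subset.antisymm hne (Set.singleton_subset_iff.2 hJ.zero_mem))
    obtain ⟨y, hy, hy0⟩ := this
    refine Set.Subset.antisymm hJx (hJ.principalRightIdeal_subset ?_)
    rcases hJx hy with rfl | ⟨s, rfl⟩
    · exact hy
    have hs : IsActive s := by
      by_contra hs
      exact hy0 (hx s hs)
    obtain ⟨v, -, -, hv⟩ := exists_right_div H hN hs hy0
    rw [← hv]
    exact hJ.2 _ hy v

variable (S) in
/-- The subsemigroup of inactive elements. -/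
def inactivePart : ZeroSubsemigroup S where
  carrier := {a | ¬ IsActive a}
  mul_mem' := fun {a _} _ hb => not_isActive_mul hb a
  zero_mem' := fun h => h.ne_zero rfl

theorem isFiniteZeroDirectUnionOfNullAndCZS_rightSocle (H : IsLeftRecoverable S)
    (hN : IsRightNoetherian S) : IsFiniteZeroDirectUnionOfNullAndCZS (rightSocle S) := by
  have := finite_linkClasses H hN KillsInactive
  let e := Finite.equivFin (LinkClasses H KillsInactive)
  have hkill : ∀ i : LinkClasses H KillsInactive, ∀ x ∈ i.1.carrier, KillsInactive x := by
    rintro ⟨_, a, ha, hQa, rfl⟩ x (rfl | ⟨hx, hax⟩)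
    · exact fun c _ => zero_mul c
    · exact hQa.of_linked H hax
  have hinact : ∀ i : LinkClasses H KillsInactive, ∀ x ∈ i.1.carrier, ¬ IsActive x → x = 0 := by
    rintro ⟨_, a, ha, hQa, rfl⟩ x (rfl | ⟨hx, hax⟩) hx'
    · rfl
    · exact absurd hx hx'
  refine ⟨inactivePart S, Nat.card (LinkClasses H KillsInactive), fun i => (e.symm i).1,
    hN.finite_not_isActive, ?_, isZeroDirectUnion_of ?_ ?_ ?_,
    fun i => (LinkClasses.hasCZSDivision H hN _).isFiniteRCompletelyZeroSimple⟩
  · refine Set.Subset.antisymm ?_ (Set.singleton_subset_iff.2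
      ⟨0, (inactivePart S).zero_mem', 0, (inactivePart S).zero_mem', zero_mul 0⟩)
    rintro _ ⟨x, hx, y, -, rfl⟩
    exact not_isActive_iff.1 hx y
  · intro x
    rw [mem_rightSocle_iff H hN]
    constructor
    · intro hx
      by_cases hact : IsActive x
      · obtain ⟨i, hi⟩ := (mem_iUnion_linkClasses H (Q := KillsInactive)
          (fun a x _ hax ha => ha.of_linked H hax) hact.ne_zero).2 ⟨hact, hx⟩
        exact ⟨some (e i), by simpa using hi⟩
      · exact ⟨none, hact⟩
    · rintro ⟨_ | i, hx⟩
      · exact fun c _ => not_isActive_iff.1 hx c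
      · exact hkill _ x hx
  · rintro (_ | i) (_ | j) hij x hi hj
    · exact absurd rfl hij
    · exact hinact _ x hj hi
    · exact hinact _ x hi hj
    · exact linkClasses_inter H (e.symm.injective.ne fun h => hij (congrArg some h)) hi hj
  · rintro (_ | i) (_ | j) hij x hi y hj
    · exact absurd rfl hij
    · exact not_isActive_iff.1 hi y
    · exact hkill _ x hi y hj
    · exact linkClasses_mul H (e.symm.injective.ne fun h => hij (congrArg some h)) hi hj

/-- The projection to the Rees quotient. -/
def reesMk (I : Set S) (hI : IsIdeal I) : S →ₙ* ReesQuotient I hI where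
  toFun x := (x : (reesCon I hI).Quotient)
  map_mul' _ _ := rfl

theorem reesMk_eq_iff {I : Set S} {hI : IsIdeal I} {x y : S} :
    reesMk I hI x = reesMk I hI y ↔ x = y ∨ x ∈ I ∧ y ∈ I :=
  (reesCon I hI).eq

theorem reesMk_surjective (I : Set S) (hI : IsIdeal I) : Function.Surjective (reesMk I hI) := by
  intro q
  induction q using Con.induction_on with
  | H x => exact ⟨x, rfl⟩

theorem reesMk_zero (I : Set S) (hI : IsIdeal I) : reesMk I hI 0 = 0 := rfl

theorem reesMk_eq_zero_iff {I : Set S} {hI : IsIdeal I} {x : S} :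
    reesMk I hI x = 0 ↔ x ∈ I := by
  rw [← reesMk_zero, reesMk_eq_iff]
  constructor
  · rintro (rfl | ⟨h, -⟩)
    · exact hI.1.zero_mem
    · exact h
  · exact fun h => Or.inr ⟨h, hI.1.zero_mem⟩

/-- A class not annihilating the inactive elements meets `Σʳ` only in `0`, so the projection has
trivial kernel on it and `HasCZSDivision.map` applies. -/
theorem isFiniteZeroDirectUnionOfCZS_reesQuotient (H : IsLeftRecoverable S)
    (hN : IsRightNoetherian S) (hne : rightSocle S ≠ Set.univ) :
    IsFiniteZeroDirectUnionOfCZS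
      (Set.univ : Set (ReesQuotient (rightSocle S) (isIdeal_rightSocle S))) := by
  have := finite_linkClasses H hN fun x => ¬ KillsInactive x
  have hsat : ∀ a x : S, IsActive x → Linked a x → ¬ KillsInactive a → ¬ KillsInactive x :=
    fun a x hx hax ha hkx => ha (hkx.of_linked H (hax.symm H hx))
  have hzero : ∀ i : LinkClasses H fun x => ¬ KillsInactive x, ∀ x ∈ i.1.carrier,
      x ∈ rightSocle S → x = 0 := by
    intro i x hx hxS
    by_contra hx0
    exact ((mem_iUnion_linkClasses H hsat hx0).1 ⟨i, hx⟩).2 ((mem_rightSocle_iff H hN).1 hxS)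
  have hmem : ∀ x ∉ rightSocle S, ∃ i : LinkClasses H fun x => ¬ KillsInactive x,
      x ∈ i.1.carrier := by
    intro x hx
    have hk : ¬ KillsInactive x := fun h => hx ((mem_rightSocle_iff H hN).2 h)
    have hact : IsActive x := by
      by_contra hact
      exact hk fun c _ => not_isActive_iff.1 hact c
    exact (mem_iUnion_linkClasses H hsat hact.ne_zero).2 ⟨hact, hk⟩
  obtain ⟨b, hb⟩ := (Set.ne_univ_iff_exists_notMem _).1 hne
  obtain ⟨i₀, -⟩ := hmem b hb
  let p := reesMk (rightSocle S) (isIdeal_rightSocle S)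
  refine isFiniteZeroDirectUnionOfCZS_of_finite
    (B := fun i : LinkClasses H fun x => ¬ KillsInactive x => i.1.map p (reesMk_zero _ _))
    (fun q => ?_) ?_ ?_ fun i => (LinkClasses.hasCZSDivision H hN i).map p (reesMk_zero _ _)
      fun x hx h => hzero i x hx (reesMk_eq_zero_iff.1 h)
  · refine ⟨fun _ => ?_, fun _ => trivial⟩
    obtain ⟨x, rfl⟩ := reesMk_surjective _ _ q
    by_cases hx : x ∈ rightSocle S
    · exact ⟨i₀, 0, i₀.1.zero_mem', (reesMk_eq_zero_iff.2 hx).symm⟩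
    · obtain ⟨i, hi⟩ := hmem x hx
      exact ⟨i, x, hi, rfl⟩
  · rintro i j hij _ ⟨x, hx, rfl⟩ ⟨y, hy, hyx⟩
    rcases reesMk_eq_iff.1 hyx with rfl | ⟨-, hxS⟩
    · rw [linkClasses_inter H hij hx hy]
      exact reesMk_zero _ _
    · exact reesMk_eq_zero_iff.2 hxS
  · rintro i j hij _ ⟨x, hx, rfl⟩ _ ⟨y, hy, rfl⟩
    rw [← map_mul, linkClasses_mul H hij hx hy]
    exact reesMk_zero _ _

end Decomposition

/-! ### Recovering finiteness of `R`-classes from the pieces. -/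

section Converse

variable {S : Type*} [SemigroupWithZero S]

theorem IsFiniteRCompletelyZeroSimple.meetsFinitelyManyRClasses {T : ZeroSubsemigroup S}
    (hT : IsFiniteRCompletelyZeroSimple T) : MeetsFinitelyManyRClasses T.carrier := by
  obtain ⟨F, hF, h⟩ := hasFinitelyManyRClasses_iff.1 hT.2
  have key : ∀ x y : T.Elem, x ∈ principalRightIdeal y →
      (x : S) ∈ principalRightIdeal (y : S) := by
    rintro x y (rfl | ⟨s, rfl⟩)
    · exact Or.inl rfl
    · exact Or.inr ⟨s, rfl⟩
  refine ⟨Subtype.val '' F, hF.image _, fun x hx => ?_⟩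
  obtain ⟨f, hf, hfx⟩ := h ⟨x, hx⟩ trivial
  rw [greenR_iff] at hfx
  exact ⟨f, ⟨f, hf, rfl⟩, greenR_iff.2 ⟨key _ _ hfx.1, key _ _ hfx.2⟩⟩

theorem IsFiniteZeroDirectUnionOfCZS.meetsFinitelyManyRClasses {X : Set S}
    (hX : IsFiniteZeroDirectUnionOfCZS X) : MeetsFinitelyManyRClasses X := by
  obtain ⟨n, B, hB, hczs⟩ := hX
  rw [hB.1]
  exact .iUnion fun i => (hczs i).meetsFinitelyManyRClasses

theorem IsFiniteZeroDirectUnionOfNullAndCZS.meetsFinitelyManyRClasses {X : Set S}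
    (hX : IsFiniteZeroDirectUnionOfNullAndCZS X) : MeetsFinitelyManyRClasses X := by
  obtain ⟨N, n, B, hN, -, hB, hczs⟩ := hX
  rw [hB.1]
  refine .iUnion ?_
  rintro (_ | i)
  · exact .of_finite hN
  · exact (hczs i).meetsFinitelyManyRClasses

/-- If the Rees quotient by `I` has finitely many `R`-classes then so does the complement
of `I`. -/
theorem meetsFinitelyManyRClasses_compl {I : Set S} {hI : IsIdeal I}
    (h : MeetsFinitelyManyRClasses (Set.univ : Set (ReesQuotient I hI))) :
    MeetsFinitelyManyRClasses Iᶜ := by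
  obtain ⟨F, hF, hcover⟩ := h
  choose g hg using reesMk_surjective I hI
  -- An equality in the quotient with one side outside `I` is already an equality in `S`.
  have key : ∀ x ∉ I, ∀ y, reesMk I hI x ∈ principalRightIdeal (reesMk I hI y) →
      x ∈ principalRightIdeal y := by
    rintro x hx y (h | ⟨s, h⟩)
    · rcases reesMk_eq_iff.1 h with h | ⟨h, -⟩
      · exact Or.inl h
      · exact absurd h hx
    · obtain ⟨s, rfl⟩ := reesMk_surjective I hI s
      rw [← map_mul] at h
      rcases reesMk_eq_iff.1 h with h | ⟨h, -⟩
      · exact Or.inr ⟨s, h⟩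
      · exact absurd h hx
  refine ⟨g '' F, hF.image g, fun x hx => ?_⟩
  obtain ⟨f, hf, hfx⟩ := hcover (reesMk I hI x) trivial
  rw [greenR_iff, ← hg f] at hfx
  have hxf := key x hx _ hfx.2
  have hfI : g f ∉ I := fun h => hx (hI.1.principalRightIdeal_subset h hxf)
  exact ⟨g f, ⟨f, hf, rfl⟩, greenR_iff.2 ⟨key _ hfI x hfx.1, hxf⟩⟩

end Converse

end SocleSemigroup

open SocleSemigroup

theorem mainTheorem8 (S : Type*) [SemigroupWithZero S]
    (hS : SocleSemigroup.leftSocle S = Set.univ) :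
    List.TFAE [
      SocleSemigroup.IsRightNoetherian S,
      (SocleSemigroup.leftNullPart S).Finite ∧
        (SocleSemigroup.leftIdempotentPart S = {0} ∨
          SocleSemigroup.IsFiniteZeroDirectUnionOfCZS (SocleSemigroup.leftIdempotentPart S)),
      (((SocleSemigroup.rightSocle S).Finite ∧
            SocleSemigroup.IsNull (SocleSemigroup.rightSocle S)) ∨
          SocleSemigroup.IsFiniteZeroDirectUnionOfNullAndCZS (SocleSemigroup.rightSocle S)) ∧
        (SocleSemigroup.rightSocle S = Set.univ ∨
          SocleSemigroup.IsFiniteZeroDirectUnionOfCZS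
            (Set.univ : Set (SocleSemigroup.ReesQuotient (SocleSemigroup.rightSocle S)
              (SocleSemigroup.isIdeal_rightSocle S)))),
      SocleSemigroup.HasFinitelyManyRClasses S] := by
  have H := isLeftRecoverable_of_leftSocle_eq_univ hS
  tfae_have 4 → 1 := fun h => h.isRightNoetherian
  tfae_have 1 → 2 := by
    intro hN
    refine ⟨hN.finite_not_isActive.subset fun a ha => (mem_leftNullPart_iff hS).1 ha, ?_⟩
    by_cases h0 : leftIdempotentPart S = {0}
    · exact Or.inl h0
    · exact Or.inr (isFiniteZeroDirectUnionOfCZS_leftIdempotentPart hS hN h0)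
  tfae_have 1 → 3 := by
    intro hN
    -- The finite null case is the decomposition with no completely 0-simple pieces, so the second
    -- alternative always serves.
    refine ⟨Or.inr (isFiniteZeroDirectUnionOfNullAndCZS_rightSocle H hN), ?_⟩
    by_cases h : rightSocle S = Set.univ
    · exact Or.inl h
    · exact Or.inr (isFiniteZeroDirectUnionOfCZS_reesQuotient H hN h)
  tfae_have 2 → 4 := by
    rintro ⟨hA, hB⟩
    have hB' : MeetsFinitelyManyRClasses (leftIdempotentPart S) := by
      rcases hB with h | h
      · exact .of_finite (h ▸ Set.finite_singleton 0)
      · exact h.meetsFinitelyManyRClasses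
    have huniv : leftNullPart S ∪ leftIdempotentPart S = Set.univ := by
      refine Set.eq_univ_of_forall fun x => ?_
      rw [Set.mem_union, mem_leftNullPart_iff hS, mem_leftIdempotentPart_iff hS]
      tauto
    exact hasFinitelyManyRClasses_iff.2 (huniv ▸ (MeetsFinitelyManyRClasses.of_finite hA).union hB')
  tfae_have 3 → 4 := by
    rintro ⟨hR, hQ⟩
    have hR' : MeetsFinitelyManyRClasses (rightSocle S) := by
      rcases hR with h | h
      · exact .of_finite h.1
      · exact h.meetsFinitelyManyRClasses
    rw [hasFinitelyManyRClasses_iff]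
    rcases hQ with h | h
    · exact h ▸ hR'
    · rw [← Set.union_compl_self (rightSocle S)]
      exact hR'.union (meetsFinitelyManyRClasses_compl h.meetsFinitelyManyRClasses)
  tfae_finish
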